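/- **Setting.** Let $\Omega\subset\mathbb R^3$ be a bounded domain, divided by a closed (compact, without boundary) embedded $C^2$ surface $\Gamma\subset\Omega$ into two disjoint open sets $\Omega^-$ and $\Omega^+$, $\Omega=\Omega^-\cup\Gamma\cup\Omega^+$, lying locally on the two sides of $\Gamma$. Let $\mathbf n$ be the unit normal on $\Gamma$ pointing from $\Omega^-$ into $\Omega^+$. For a field $F$ on $\Omega^-\cup\Omega^+$ and $x\in\Gamma$ put $$[F](x)=\lim_{\epsilon\to0^+}F(x+\epsilon\,\mathbf n(x))-\lim_{\epsilon\to0^+}F(x-\epsilon\,\mathbf n(x)).$$ Write $\nabla_s=(I-\mathbf n\otimes\mathbf n)\nabla$ for the surface gradient on $\Gamma$, $\nabla_s\cdot\mathbf v$ for the surface divergence (the trace of the tangential derivative of $\mathbf v$), $\nabla_s^2=\nabla_s\cdot\nabla_s$ for the surface Laplacian (acting on Cartesian components of vector fields), and $H=\nabla_s\cdot\mathbf n$ for the total curvature. At $x\in\Gamma$, $\partial/\partial n$ is the derivative in the fixed direction $\mathbf n(x)$ and $\partial^2/\partial n^2$ is its second iterate. Let the viscosity $\mu$ be a positive constant $\mu^\pm$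 in $\Omega^\pm$. Let $\mathbf u:\Omega\to\mathbb R^3$ be continuous on $\Omega$ and of class $C^2$ in each of $\Omega^\pm$ up to $\Gamma$; let $p$ be of class $C^1$ in each of $\Omega^\pm$ up to $\Gamma$; and let $\mathbf g$ be a body force such that $$\nabla p=\mu\nabla^2\mathbf u+\mathbf g,\qquad \nabla\cdot\mathbf u=0\qquad\text{in }\Omega^-\text{ and in }\Omega^+ .$$ Let $\mathbf q=\mathbf u|_\Gamma$ be the interface velocity, and suppose that the interface is incompressible, $\nabla_s\cdot\mathbf q=0$ on $\Gamma$, and that the singular interface force $\mathbf f$ on $\Gamma$ balances the stress, $$[\boldsymbol\sigma\,\mathbf n]=\mathbf f\quad\text{on }\Gamma,\qquad \boldsymbol\sigma=-pI+\mu\left(\nabla\mathbf u+(\nabla\mathbf u)^T\right).$$ **Theorem.** At every point of $\Gamma$ the surface derivatives and the jumps below exist, and the jump in the second normal derivative of the augmented velocity $\mu\mathbf u$ is $$\left[\mu\frac{\partial^2\mathbf u}{\partial n^2}\right]=-[\mu]\,\nabla_s^2\mathbf q-\left[\mu\frac{\partial\mathbf u}{\partial n}\right]H+\left[\frac{\partial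 p}{\partial n}\right]\mathbf n-\nabla_s(\mathbf f\cdot\mathbf n)-[\mathbf g].$$ -/

import Mathlib

open Set Filter Topology
open scoped InnerProductSpace

noncomputable section

namespace StokesInterface

/-- Three-dimensional Euclidean space, used both for points and for vectors. -/
abbrev E3 : Type := EuclideanSpace ℝ (Fin 3)

/-! ### Derivatives in the bulk -/

/-- Divergence of a vector field: the trace of its derivative. -/
def divergence (v : E3 → E3) (x : E3) : ℝ :=
  LinearMap.trace ℝ E3 (fderiv ℝ v x : E3 →ₗ[ℝ] E3)

/-- First derivative of `F` in the fixed direction `ν`, as a function of the point. -/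
def dirDeriv {V : Type*} [NormedAddCommGroup V] [NormedSpace ℝ V]
    (ν : E3) (F : E3 → V) (y : E3) : V :=
  fderiv ℝ F y ν

/-- The traction `σ ν` of the Stokes stress tensor `σ = -p I + μ (∇u + (∇u)ᵀ)`. -/
def traction (μ : E3 → ℝ) (u : E3 → E3) (p : E3 → ℝ) (ν : E3) (y : E3) : E3 :=
  -(p y • ν) + μ y • (fderiv ℝ u y ν + ContinuousLinearMap.adjoint (fderiv ℝ u y) ν)

/-- `F` is of class `C^k` in `D` up to the surface `Γ`: on `D` it coincides with a function which is
`C^k` on `D ∪ Γ` (one-sided derivatives on `Γ`). The values of `F` on `Γ` play no role. -/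
def ContDiffUpTo {V : Type*} [NormedAddCommGroup V] [NormedSpace ℝ V]
    (k : ℕ) (F : E3 → V) (D Γ : Set E3) : Prop :=
  ∃ G : E3 → V, ContDiffOn ℝ k G (D ∪ Γ) ∧ EqOn F G D

/-! ### Jumps -/

/-- The jump `[F]` at `x` along the normal direction `ν` exists and equals `J`, where
`[F] = lim_{ε → 0+} F (x + ε ν) - lim_{ε → 0+} F (x - ε ν)`, both limits being finite. -/
def HasJump {V : Type*} [NormedAddCommGroup V] [NormedSpace ℝ V]
    (F : E3 → V) (x ν : E3) (J : V) : Prop :=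
  ∃ a b : V, Tendsto (fun ε : ℝ => F (x + ε • ν)) (𝓝[>] 0) (𝓝 a) ∧
    Tendsto (fun ε : ℝ => F (x - ε • ν)) (𝓝[>] 0) (𝓝 b) ∧ J = a - b

/-! ### Surface calculus

Functions on the surface `Γ` are represented by functions on `E3`, of which only the values on `Γ`
matter. The derivative within `Γ` is unique only in tangential directions; each operator below
composes it with the tangential projection, so that the result does not depend on the choice. -/

/-- The tangential projection `I - ν ⊗ ν`. -/
def tangProj (ν : E3) : E3 →L[ℝ] E3 :=
  ContinuousLinearMap.id ℝ E3 - (innerSL ℝ ν).smulRight ν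

/-- Surface gradient `∇ₛ φ = (I - n ⊗ n) ∇φ` of a scalar function on `Γ`. -/
def surfGrad (Γ : Set E3) (n : E3 → E3) (φ : E3 → ℝ) (x : E3) : E3 :=
  tangProj (n x) (gradientWithin φ Γ x)

/-- Surface divergence `∇ₛ · v` of a (not necessarily tangential) vector field on `Γ`: the trace of
its tangential derivative, that is `∂v/∂t · t + ∂v/∂b · b` in an orthonormal frame `(n, t, b)`. -/
def surfDiv (Γ : Set E3) (n : E3 → E3) (v : E3 → E3) (x : E3) : ℝ :=
  LinearMap.trace ℝ E3 ((fderivWithin ℝ v Γ x).comp (tangProj (n x)) : E3 →ₗ[ℝ] E3)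

/-- Surface (Laplace-Beltrami) Laplacian `∇ₛ² φ = ∇ₛ · ∇ₛ φ` of a scalar function on `Γ`. -/
def surfLaplacian (Γ : Set E3) (n : E3 → E3) (φ : E3 → ℝ) (x : E3) : ℝ :=
  surfDiv Γ n (surfGrad Γ n φ) x

/-- Surface Laplacian of a vector field on `Γ`, taken on the Cartesian components. -/
def surfVecLaplacian (Γ : Set E3) (n : E3 → E3) (v : E3 → E3) (x : E3) : E3 :=
  WithLp.toLp 2 (fun i : Fin 3 => surfLaplacian Γ n (fun y => v y i) x)

/-- Total curvature `H = ∇ₛ · n` (the sum of the principal curvatures; `2 / R` for a sphere of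
radius `R` with its outward normal). -/
def totalCurvature (Γ : Set E3) (n : E3 → E3) (x : E3) : ℝ :=
  surfDiv Γ n n x

/-! ### Geometry and the two-phase Stokes system -/

/-- The bounded domain `Ω` is divided by the closed (compact, without boundary) embedded `C²`
surface `Γ ⊆ Ω` into the open sets `Ωm` (that is, `Ω⁻`) and `Ωp` (that is, `Ω⁺`), which lie locally
on the two sides of `Γ`, and on `Γ` the field `n` is the unit normal pointing from `Ωm` into `Ωp`.
Near each of its points `Γ` is the zero set of a `C²` function `φ` with non-vanishing gradient, with
`φ < 0` in `Ωm` and `φ > 0` in `Ωp`, and `n = ∇φ / |∇φ|`. -/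
structure IsInterface (Ω Ωm Ωp Γ : Set E3) (n : E3 → E3) : Prop where
  isOpen_domain : IsOpen Ω
  isConnected_domain : IsConnected Ω
  isBounded_domain : Bornology.IsBounded Ω
  isCompact_surface : IsCompact Γ
  isOpen_minus : IsOpen Ωm
  isOpen_plus : IsOpen Ωp
  disjoint_minus_plus : Disjoint Ωm Ωp
  disjoint_minus_surface : Disjoint Ωm Γ
  disjoint_plus_surface : Disjoint Ωp Γ
  union_eq : Ωm ∪ Γ ∪ Ωp = Ω
  local_level_set : ∀ x ∈ Γ, ∃ (U : Set E3) (φ : E3 → ℝ), IsOpen U ∧ x ∈ U ∧ ContDiffOn ℝ 2 φ U ∧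
    ∀ y ∈ U, gradient φ y ≠ 0 ∧ (y ∈ Ωm ↔ φ y < 0) ∧ (y ∈ Γ ↔ φ y = 0) ∧ (y ∈ Ωp ↔ 0 < φ y) ∧
      (y ∈ Γ → n y = ‖gradient φ y‖⁻¹ • gradient φ y)

/-- `(u, p)` is a piecewise classical solution, regular up to `Γ` from both sides, of the two-phase
Stokes system with piecewise constant viscosity `μ`, body force `g`, incompressible interface
moving with velocity `q`, and singular interface force `f`. The fields `u`, `p`, `μ`, `g` live on
`Ω`; `q` and `f` matter on `Γ` only. -/
structure IsStokesFlow (Ω Ωm Ωp Γ : Set E3) (n : E3 → E3) (μ : E3 → ℝ) (u : E3 → E3) (p : E3 → ℝ)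
    (g q f : E3 → E3) : Prop where
  viscosity_minus : ∃ c : ℝ, 0 < c ∧ ∀ y ∈ Ωm, μ y = c
  viscosity_plus : ∃ c : ℝ, 0 < c ∧ ∀ y ∈ Ωp, μ y = c
  velocity_continuous : ContinuousOn u Ω
  velocity_minus : ContDiffUpTo 2 u Ωm Γ
  velocity_plus : ContDiffUpTo 2 u Ωp Γ
  pressure_minus : ContDiffUpTo 1 p Ωm Γ
  pressure_plus : ContDiffUpTo 1 p Ωp Γ
  momentum : ∀ y ∈ Ωm ∪ Ωp, gradient p y = μ y • Laplacian.laplacian u y + g y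
  incompressible : ∀ y ∈ Ωm ∪ Ωp, divergence u y = 0
  no_slip : ∀ x ∈ Γ, q x = u x
  interface_incompressible : ∀ x ∈ Γ, surfDiv Γ n q x = 0
  stress_balance : ∀ x ∈ Γ, HasJump (traction μ u p (n x)) x (n x) (f x)

end StokesInterface

end

/-! On each side let `A` and `B` be the limits on `Γ` of the first and second derivatives of `u`.
Since `u` is continuous across `Γ`, both one-sided extensions restrict to `q`, so surface
derivatives of `q` can be computed from either side. This gives `∇ₛ² q = Δu - B(n,n) - H A n`
(`IsNormalField.surfLaplacian_eq`). Solving for `B(n,n)`, multiplying by the viscosity and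
substituting `μ Δu = ∇p - g`, the jump of `μ B(n,n)` becomes `[∇p] - [g] - [μ] ∇ₛ² q - H [μ A n]`.

It remains to split `[∇p] = [∂p/∂n] n + ∇ₛ[p]` and to see that `f · n = -[p]`. Comparing `∇ · u = 0`
with `∇ₛ · q = 0` gives `n · A n = 0` (`IsSideFlow.inner_normal_deriv`), so viscous stress has no
normal component and only pressure enters `f · n`. -/

namespace StokesInterface

open InnerProductSpace

/-! ### Level sets -/

section LevelSet

variable {E : Type*} [NormedAddCommGroup E] [NormedSpace ℝ E]
  {φ : E → ℝ} {φ' : E →L[ℝ] ℝ} {x v : E}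

/-- A direction annihilated by the derivative of a submersion is tangent to its level set. -/
theorem mem_tangentConeAt_of_levelSet [CompleteSpace E] {Γ : Set E} (h : HasStrictFDerivAt φ φ' x)
    (hne : φ' ≠ 0) (hΓ : ∀ᶠ y in 𝓝 x, φ y = φ x → y ∈ Γ) (hv : φ' v = 0) :
    v ∈ tangentConeAt ℝ Γ x := by
  have hsurj : φ'.range = ⊤ := LinearMap.range_eq_top.2
    (LinearMap.surjective (fun h0 => hne (ContinuousLinearMap.coe_injective h0)))
  let k : φ'.ker := ⟨v, hv⟩
  -- The implicit function theorem gives a curve in the level set with velocity `v` at `x`; its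
  -- difference quotients exhibit `v` as a tangent vector.
  let γ : ℝ → E := fun t => h.implicitFunction φ φ' hsurj (φ x) (t • k)
  have hγ0 : γ 0 = x := by simp [γ]
  have hline : HasDerivAt (fun t : ℝ => t • k) k 0 := by
    simpa using (hasDerivAt_id (0 : ℝ)).smul_const k
  have hγ : HasDerivAt γ v 0 := by
    have h1 : HasFDerivAt (h.implicitFunction φ φ' hsurj (φ x)) φ'.ker.subtypeL ((0 : ℝ) • k) := by
      simpa using (h.to_implicitFunction hsurj).hasFDerivAt
    exact h1.comp_hasDerivAt (0 : ℝ) hline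
  have hγc : Tendsto γ (𝓝[>] 0) (𝓝 x) := by
    simpa [hγ0] using (hγ.continuousAt.tendsto.mono_left nhdsWithin_le_nhds :
      Tendsto γ (𝓝[>] 0) (𝓝 (γ 0)))
  have hpair : Tendsto (fun t : ℝ => (φ x, t • k)) (𝓝[>] 0) (𝓝 (φ x, 0)) := by
    refine Tendsto.mono_left ?_ nhdsWithin_le_nhds
    refine tendsto_const_nhds.prodMk_nhds ?_
    simpa using hline.continuousAt.tendsto
  refine mem_tangentConeAt_of_seq (𝓝[>] (0 : ℝ)) (fun t => t⁻¹) (fun t => γ t - x) ?_ ?_ ?_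
  · simpa using hγc.sub_const x
  · filter_upwards [hγc.eventually hΓ, hpair.eventually (h.map_implicitFunction_eq hsurj)]
      with t h1 h2
    simpa using h1 h2
  · simpa [hγ0] using hγ.tendsto_slope_zero_right

/-- A ray along which `φ` increases from a zero enters the set where `φ` is positive. -/
theorem eventually_mem_of_levelSet_of_pos {D : Set E} (h : HasFDerivAt φ φ' x) (h0 : φ x = 0)
    (hD : ∀ᶠ y in 𝓝 x, 0 < φ y → y ∈ D) (hv : 0 < φ' v) :
    ∀ᶠ t in 𝓝[>] (0 : ℝ), x + t • v ∈ D := by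
  have hl : HasDerivAt (fun t : ℝ => x + t • v) v 0 := by
    simpa using ((hasDerivAt_id (0 : ℝ)).smul_const v).const_add x
  have hd : HasDerivAt (fun t : ℝ => φ (x + t • v)) (φ' v) 0 := by
    refine HasFDerivAt.comp_hasDerivAt (0 : ℝ) ?_ hl
    simpa using h
  have hlt : Tendsto (fun t : ℝ => x + t • v) (𝓝[>] 0) (𝓝 x) := by
    refine Tendsto.mono_left ?_ nhdsWithin_le_nhds
    simpa using hl.continuousAt.tendsto
  filter_upwards [hd.tendsto_slope_zero_right.eventually (lt_mem_nhds hv), hlt.eventually hD,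
    self_mem_nhdsWithin] with t h1 h2 h3
  refine h2 ?_
  have ht : (0 : ℝ) < t := h3
  simp only [zero_add, zero_smul, add_zero, h0, sub_zero, smul_eq_mul] at h1
  exact (pos_iff_pos_of_mul_pos h1).1 (inv_pos.2 ht)

/-- A set that contains the superlevel set of a submersion has unique derivatives at points of the
level set. -/
theorem uniqueDiffWithinAt_of_levelSet {D : Set E} (h : HasFDerivAt φ φ' x) (hne : φ' ≠ 0)
    (h0 : φ x = 0) (hD : ∀ᶠ y in 𝓝 x, 0 < φ y → y ∈ D) : UniqueDiffWithinAt ℝ D x := by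
  have hcone : ∀ w, 0 < φ' w → w ∈ tangentConeAt ℝ D x := fun w hw =>
    mem_tangentConeAt_of_add_smul_mem (tendsto_id'.mpr <| nhdsGT_le_nhdsNE 0)
      (eventually_mem_of_levelSet_of_pos h h0 hD hw)
  obtain ⟨w, hw⟩ : ∃ w, φ' w = 1 :=
    LinearMap.surjective (f := (φ' : E →ₗ[ℝ] ℝ))
      (fun h0 => hne (ContinuousLinearMap.coe_injective h0)) 1
  have hspan : Submodule.span ℝ (tangentConeAt ℝ D x) = ⊤ := by
    refine eq_top_iff.2 fun v _ => ?_
    -- Adding this multiple of `w` moves any `v` into the open half-space `φ' > 0`, which therefore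
    -- spans.
    have h1 : v + (|φ' v| + 1) • w ∈ Submodule.span ℝ (tangentConeAt ℝ D x) := by
      refine Submodule.subset_span (hcone _ ?_)
      simp only [map_add, map_smul, hw, smul_eq_mul, mul_one]
      linarith [neg_abs_le (φ' v)]
    have h2 : w ∈ Submodule.span ℝ (tangentConeAt ℝ D x) :=
      Submodule.subset_span (hcone _ (by rw [hw]; exact one_pos))
    simpa using Submodule.sub_mem _ h1 (Submodule.smul_mem _ (|φ' v| + 1) h2)
  exact ⟨by rw [hspan]; exact dense_univ, mem_closure_of_nonempty_tangentConeAt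
    ⟨w, hcone w (by rw [hw]; exact one_pos)⟩⟩

end LevelSet

/-! ### Traces and the tangential projection -/

theorem inner_tangProj (ν v w : E3) : ⟪tangProj ν v, w⟫_ℝ = ⟪v, tangProj ν w⟫_ℝ := by
  simp only [tangProj, sub_apply, ContinuousLinearMap.id_apply,
    ContinuousLinearMap.smulRight_apply, innerSL_apply_apply, inner_sub_left, inner_sub_right,
    inner_smul_left, inner_smul_right, real_inner_comm ν v]
  simp
  ring

theorem tangProj_apply (ν v : E3) : tangProj ν v = v - ⟪ν, v⟫_ℝ • ν := by
  simp [tangProj]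

theorem inner_self_tangProj {ν : E3} (hν : ‖ν‖ = 1) (v : E3) : ⟪ν, tangProj ν v⟫_ℝ = 0 := by
  simp [tangProj_apply, inner_sub_right, inner_smul_right, hν]

theorem trace_eq_sum (L : E3 →L[ℝ] E3) :
    LinearMap.trace ℝ E3 (L : E3 →ₗ[ℝ] E3)
      = ∑ i, ⟪stdOrthonormalBasis ℝ E3 i, L (stdOrthonormalBasis ℝ E3 i)⟫_ℝ :=
  LinearMap.trace_eq_sum_inner _ (stdOrthonormalBasis ℝ E3)

/-- The projection removes the rank-one map `v ↦ ⟪ν, v⟫ L ν`, whose trace is `⟪ν, L ν⟫`. -/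
theorem trace_comp_tangProj (L : E3 →L[ℝ] E3) (ν : E3) :
    LinearMap.trace ℝ E3 (L.comp (tangProj ν) : E3 →ₗ[ℝ] E3)
      = LinearMap.trace ℝ E3 (L : E3 →ₗ[ℝ] E3) - ⟪ν, L ν⟫_ℝ := by
  have : (L.comp (tangProj ν) : E3 →ₗ[ℝ] E3)
      = (L : E3 →ₗ[ℝ] E3) - ((innerSL ℝ ν : E3 →L[ℝ] ℝ) : E3 →ₗ[ℝ] ℝ).smulRight (L ν) := by
    ext1 v; simp [tangProj_apply]
  rw [this, map_sub, LinearMap.trace_smulRight]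
  simp

/-- The rank-one operator `ν ⊗ ℓ` has no trace on the plane orthogonal to `ν`. -/
theorem trace_smulRight_comp_tangProj (ℓ : E3 →L[ℝ] ℝ) {ν : E3} (hν : ‖ν‖ = 1) :
    LinearMap.trace ℝ E3 ((ℓ.smulRight ν).comp (tangProj ν) : E3 →ₗ[ℝ] E3) = 0 := by
  rw [trace_comp_tangProj]
  have : ((ℓ.smulRight ν : E3 →L[ℝ] E3) : E3 →ₗ[ℝ] E3) = (ℓ : E3 →ₗ[ℝ] ℝ).smulRight ν := rfl
  rw [this, LinearMap.trace_smulRight]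
  simp [inner_smul_right, hν]

/-! ### Surface operators through any derivative within the surface -/

/-- Every vector orthogonal to the unit vector `n y` is tangent to `Γ` at `y`, for all `y ∈ Γ`. -/
def IsNormalField (Γ : Set E3) (n : E3 → E3) : Prop :=
  ∀ y ∈ Γ, ‖n y‖ = 1 ∧ ∀ v, ⟪n y, v⟫_ℝ = 0 → v ∈ tangentConeAt ℝ Γ y

section SurfaceOperators

variable {Γ : Set E3} {n : E3 → E3} {x : E3}

/-- Derivatives within `Γ` are determined only on the tangent cone, which contains the range of the
projection. Any derivative within `Γ`, such as a one-sided bulk derivative, may thus replace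
`fderivWithin`. -/
theorem IsNormalField.fderivWithin_comp_tangProj {V : Type*} [NormedAddCommGroup V]
    [NormedSpace ℝ V] (hn : IsNormalField Γ n) (hx : x ∈ Γ) {v : E3 → V} {v' : E3 →L[ℝ] V}
    (hv : HasFDerivWithinAt v v' Γ x) :
    (fderivWithin ℝ v Γ x).comp (tangProj (n x)) = v'.comp (tangProj (n x)) := by
  ext1 w
  exact hv.differentiableWithinAt.hasFDerivWithinAt.unique_on hv
    ((hn x hx).2 _ (inner_self_tangProj (hn x hx).1 w))

theorem IsNormalField.surfDiv_eq (hn : IsNormalField Γ n) (hx : x ∈ Γ) {v : E3 → E3}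
    {v' : E3 →L[ℝ] E3} (hv : HasFDerivWithinAt v v' Γ x) :
    surfDiv Γ n v x = LinearMap.trace ℝ E3 (v'.comp (tangProj (n x)) : E3 →ₗ[ℝ] E3) := by
  rw [surfDiv, hn.fderivWithin_comp_tangProj hx hv]

theorem IsNormalField.surfGrad_eq (hn : IsNormalField Γ n) (hx : x ∈ Γ) {φ : E3 → ℝ}
    {φ' : E3 →L[ℝ] ℝ} (hφ : HasFDerivWithinAt φ φ' Γ x) :
    surfGrad Γ n φ x = tangProj (n x) ((toDual ℝ E3).symm φ') := by
  refine ext_inner_right ℝ fun w => ?_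
  rw [surfGrad, inner_tangProj, inner_tangProj, gradientWithin, toDual_symm_apply,
    toDual_symm_apply]
  exact congrArg (fun L : E3 →L[ℝ] ℝ => L w) (hn.fderivWithin_comp_tangProj hx hφ)

/-- The Riesz isomorphism from covectors to vectors, as a continuous linear map. -/
noncomputable def sharp : (E3 →L[ℝ] ℝ) →L[ℝ] E3 :=
  LinearMap.toContinuousLinearMap
    { toFun := fun ℓ => (toDual ℝ E3).symm ℓ
      map_add' := fun a b => map_add _ a b
      map_smul' := fun c a => by simp }

theorem inner_sharp (ℓ : E3 →L[ℝ] ℝ) (w : E3) : ⟪sharp ℓ, w⟫_ℝ = ℓ w :=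
  toDual_symm_apply

/-- The surface gradient of `ψ` is differentiable within `Γ` when the derivative of `ψ` along `Γ`
extends to a differentiable covector field, and the surface Laplacian is the full Laplacian minus
the second normal derivative minus the total curvature times the normal derivative. -/
theorem IsNormalField.surfLaplacian_eq (hn : IsNormalField Γ n) (hx : x ∈ Γ)
    (hnd : DifferentiableWithinAt ℝ n Γ x) {ψ : E3 → ℝ} {α : E3 → E3 →L[ℝ] ℝ}
    {β : E3 →L[ℝ] E3 →L[ℝ] ℝ} (hψ : ∀ y ∈ Γ, HasFDerivWithinAt ψ (α y) Γ y)
    (hα : HasFDerivWithinAt α β Γ x) :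
    DifferentiableWithinAt ℝ (surfGrad Γ n ψ) Γ x ∧
    surfLaplacian Γ n ψ x
      = (∑ i, β (stdOrthonormalBasis ℝ E3 i) (stdOrthonormalBasis ℝ E3 i))
        - β (n x) (n x) - α x (n x) * totalCurvature Γ n x := by
  obtain ⟨n', hn'⟩ := hnd
  have hgrad : ∀ y ∈ Γ, surfGrad Γ n ψ y = sharp (α y) - α y (n y) • n y := by
    intro y hy
    have h1 : ⟪n y, sharp (α y)⟫_ℝ = α y (n y) := by rw [real_inner_comm, inner_sharp]
    rw [hn.surfGrad_eq hy (hψ y hy), ← h1]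
    exact tangProj_apply _ _
  have hs : HasFDerivWithinAt (fun y => sharp (α y)) (sharp.comp β) Γ x :=
    sharp.hasFDerivAt.comp_hasFDerivWithinAt x hα
  -- The product rule on `α(n) n` yields `α(n) n'`, the source of the curvature term, and a rank-one
  -- term with values along `n`, which has no tangential trace.
  have hV := (hs.sub ((hα.clm_apply hn').smul hn')).congr hgrad (hgrad x hx)
  refine ⟨hV.differentiableWithinAt, ?_⟩
  rw [surfLaplacian, hn.surfDiv_eq hx hV, totalCurvature, hn.surfDiv_eq hx hn',
    ContinuousLinearMap.sub_comp, ContinuousLinearMap.add_comp, ContinuousLinearMap.smul_comp]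
  simp only [ContinuousLinearMap.toLinearMap_sub, ContinuousLinearMap.toLinearMap_add,
    ContinuousLinearMap.toLinearMap_smul, map_sub, map_add, map_smul]
  rw [trace_smulRight_comp_tangProj _ (hn x hx).1, trace_comp_tangProj (sharp.comp β),
    trace_eq_sum]
  have h2 : ∀ e, ⟪e, (sharp.comp β) e⟫_ℝ = β e e := fun e => by
    rw [real_inner_comm]; exact inner_sharp _ _
  simp only [h2, smul_eq_mul]
  ring

end SurfaceOperators

/-! ### The two sides of the interface -/

/-- `D` is open and lies locally on one side of `Γ`, the side into which `ν` points. -/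
structure IsSide (D Γ : Set E3) (ν : E3 → E3) : Prop where
  isOpen : IsOpen D
  local_level_set : ∀ x ∈ Γ, ∃ (φ : E3 → ℝ) (φ' : E3 →L[ℝ] ℝ), HasFDerivAt φ φ' x ∧ φ x = 0 ∧
    (∀ᶠ y in 𝓝 x, 0 < φ y → y ∈ D) ∧ 0 < φ' (ν x)

section Side

variable {D Γ : Set E3} {ν : E3 → E3} {x : E3}

/-- This makes the one-sided derivatives on `Γ` well defined, and hence continuous up to `Γ` for a
regular extension. -/
theorem IsSide.uniqueDiffOn (h : IsSide D Γ ν) : UniqueDiffOn ℝ (D ∪ Γ) := by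
  rintro x (hx | hx)
  · exact uniqueDiffWithinAt_of_mem_nhds
      (mem_of_superset (h.isOpen.mem_nhds hx) subset_union_left)
  · obtain ⟨φ, φ', hφ, h0, hD, hν⟩ := h.local_level_set x hx
    refine (uniqueDiffWithinAt_of_levelSet hφ ?_ h0 hD).mono subset_union_left
    rintro rfl
    simp at hν

/-- Reduces the ray limits in `HasJump` to limits from within `D`. -/
theorem IsSide.tendsto_ray (h : IsSide D Γ ν) (hx : x ∈ Γ) :
    Tendsto (fun ε : ℝ => x + ε • ν x) (𝓝[>] 0) (𝓝[D] x) := by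
  obtain ⟨φ, φ', hφ, h0, hD, hν⟩ := h.local_level_set x hx
  refine tendsto_nhdsWithin_iff.2 ⟨?_, eventually_mem_of_levelSet_of_pos hφ h0 hD hν⟩
  refine Tendsto.mono_left ?_ nhdsWithin_le_nhds
  exact Continuous.tendsto' (by fun_prop) _ _ (by simp)

theorem IsSide.neBot (h : IsSide D Γ ν) (hx : x ∈ Γ) : (𝓝[D] x).NeBot :=
  (h.tendsto_ray hx).neBot

variable {V : Type*} [NormedAddCommGroup V] [NormedSpace ℝ V] {F G : E3 → V}

theorem eqOn_fderiv_fderivWithin (hD : IsOpen D) (hFG : EqOn F G D) :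
    EqOn (fderiv ℝ F) (fderivWithin ℝ G (D ∪ Γ)) D := fun y hy => by
  have hy' := hD.mem_nhds hy
  rw [(hFG.eventuallyEq_of_mem hy').fderiv_eq,
    fderivWithin_of_mem_nhds (mem_of_superset hy' subset_union_left)]

theorem tendsto_of_eqOn {V : Type*} [TopologicalSpace V] {F G : E3 → V}
    (hG : ContinuousOn G (D ∪ Γ)) (hFG : EqOn F G D) (hx : x ∈ Γ) :
    Tendsto F (𝓝[D] x) (𝓝 (G x)) :=
  ((hG x (Or.inr hx)).mono_left (nhdsWithin_mono x subset_union_left)).congr'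
    (hFG.symm.eventuallyEq_of_mem self_mem_nhdsWithin)

theorem tendsto_apply {α W : Type*} [NormedAddCommGroup W] [NormedSpace ℝ W] {l : Filter α}
    {L : α → W →L[ℝ] V} {L₀ : W →L[ℝ] V} (h : Tendsto L l (𝓝 L₀)) (w : W) :
    Tendsto (fun y => L y w) l (𝓝 (L₀ w)) :=
  ((ContinuousLinearMap.apply ℝ V w).continuous.tendsto L₀).comp h

theorem IsSide.tendsto_fderiv (h : IsSide D Γ ν) (hx : x ∈ Γ) (hG : ContDiffOn ℝ 1 G (D ∪ Γ))
    (hFG : EqOn F G D) : Tendsto (fderiv ℝ F) (𝓝[D] x) (𝓝 (fderivWithin ℝ G (D ∪ Γ) x)) :=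
  tendsto_of_eqOn (hG.continuousOn_fderivWithin h.uniqueDiffOn le_rfl)
    (eqOn_fderiv_fderivWithin h.isOpen hFG) hx

theorem IsSide.tendsto_fderiv_fderiv (h : IsSide D Γ ν) (hx : x ∈ Γ)
    (hG : ContDiffOn ℝ 2 G (D ∪ Γ)) (hFG : EqOn F G D) :
    Tendsto (fderiv ℝ (fderiv ℝ F)) (𝓝[D] x)
      (𝓝 (fderivWithin ℝ (fderivWithin ℝ G (D ∪ Γ)) (D ∪ Γ) x)) :=
  -- The first-order result is reused, with the one-sided derivative of `G` as the extension of
  -- `fderiv ℝ F`.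
  h.tendsto_fderiv hx (hG.fderivWithin h.uniqueDiffOn (by norm_num))
    (eqOn_fderiv_fderivWithin h.isOpen hFG)

theorem differentiableAt_of_eqOn {y : E3} (hD : IsOpen D) (hy : y ∈ D)
    (hG : ContDiffOn ℝ 1 G (D ∪ Γ)) (hFG : EqOn F G D) : DifferentiableAt ℝ F y :=
  (((hG.differentiableOn one_ne_zero).differentiableAt
    (mem_of_superset (hD.mem_nhds hy) subset_union_left))).congr_of_eventuallyEq
    (hFG.eventuallyEq_of_mem (hD.mem_nhds hy))

theorem IsSide.dirDeriv_dirDeriv (h : IsSide D Γ ν) {y : E3} (hy : y ∈ D)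
    (hG : ContDiffOn ℝ 2 G (D ∪ Γ)) (hFG : EqOn F G D) (e : E3) :
    dirDeriv e (dirDeriv e F) y = fderiv ℝ (fderiv ℝ F) y e e := by
  have hd : DifferentiableAt ℝ (fderiv ℝ F) y :=
    differentiableAt_of_eqOn h.isOpen hy (hG.fderivWithin h.uniqueDiffOn (by norm_num))
      (eqOn_fderiv_fderivWithin h.isOpen hFG)
  have h1 : HasFDerivAt (dirDeriv e F) _ y :=
    hd.hasFDerivAt.clm_apply (hasFDerivAt_const e y)
  rw [dirDeriv, h1.fderiv]
  simp

theorem laplacian_eq_sum_fderiv (F : E3 → V) (y : E3) :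
    Laplacian.laplacian F y = ∑ i, fderiv ℝ (fderiv ℝ F) y
      (stdOrthonormalBasis ℝ E3 i) (stdOrthonormalBasis ℝ E3 i) := by
  rw [laplacian_eq_iteratedFDeriv_stdOrthonormalBasis]
  simp [iteratedFDeriv_two_apply]

end Side

/-! ### Geometry of an interface -/

section Interface

variable {Ω Ωm Ωp Γ : Set E3} {n : E3 → E3} {x : E3}

theorem inner_gradient (φ : E3 → ℝ) (x v : E3) : ⟪gradient φ x, v⟫_ℝ = fderiv ℝ φ x v :=
  toDual_symm_apply

theorem IsInterface.isSide_plus (h : IsInterface Ω Ωm Ωp Γ n) : IsSide Ωp Γ n := by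
  refine ⟨h.isOpen_plus, fun x hx => ?_⟩
  obtain ⟨U, φ, hU, hxU, hφ, hloc⟩ := h.local_level_set x hx
  obtain ⟨hne, -, hΓ, -, hn⟩ := hloc x hxU
  have hd := (hφ.contDiffAt (hU.mem_nhds hxU)).differentiableAt two_ne_zero
  refine ⟨φ, fderiv ℝ φ x, hd.hasFDerivAt, hΓ.1 hx, ?_, ?_⟩
  · filter_upwards [hU.mem_nhds hxU] with y hy
    exact (hloc y hy).2.2.2.1.2
  · rw [hn hx, ← inner_gradient, inner_smul_right]
    have := norm_pos_iff.2 hne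
    exact mul_pos (inv_pos.2 this) (real_inner_self_pos.2 hne)

theorem IsInterface.isSide_minus (h : IsInterface Ω Ωm Ωp Γ n) :
    IsSide Ωm Γ (fun y => -n y) := by
  refine ⟨h.isOpen_minus, fun x hx => ?_⟩
  obtain ⟨U, φ, hU, hxU, hφ, hloc⟩ := h.local_level_set x hx
  obtain ⟨hne, -, hΓ, -, hn⟩ := hloc x hxU
  have hd := (hφ.contDiffAt (hU.mem_nhds hxU)).differentiableAt two_ne_zero
  refine ⟨fun y => -φ y, -fderiv ℝ φ x, hd.hasFDerivAt.neg, by simp [hΓ.1 hx], ?_, ?_⟩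
  · filter_upwards [hU.mem_nhds hxU] with y hy hpos
    exact (hloc y hy).2.1.2 (neg_pos.1 hpos)
  · rw [hn hx, neg_apply, map_neg, neg_neg, ← inner_gradient,
      inner_smul_right]
    have := norm_pos_iff.2 hne
    exact mul_pos (inv_pos.2 this) (real_inner_self_pos.2 hne)

theorem IsInterface.isNormalField (h : IsInterface Ω Ωm Ωp Γ n) : IsNormalField Γ n := by
  intro x hx
  obtain ⟨U, φ, hU, hxU, hφ, hloc⟩ := h.local_level_set x hx
  obtain ⟨hne, -, hΓ, -, hn⟩ := hloc x hxU
  have hg := norm_pos_iff.2 hne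
  rw [hn hx]
  refine ⟨norm_smul_inv_norm hne, fun v hv => ?_⟩
  refine mem_tangentConeAt_of_levelSet
    ((hφ.contDiffAt (hU.mem_nhds hxU)).hasStrictFDerivAt two_ne_zero) ?_ ?_ ?_
  · intro h0
    exact hne (by rw [gradient, h0, map_zero])
  · filter_upwards [hU.mem_nhds hxU] with y hy hy0
    exact (hloc y hy).2.2.1.2 (hy0.trans (hΓ.1 hx))
  · rw [inner_smul_left, mul_eq_zero] at hv
    rw [← inner_gradient]
    refine hv.resolve_left ?_
    simpa using hg.ne'

/-- On `Γ` the field `n` agrees with `∇φ / |∇φ|`, which is differentiable at `x` because `φ` is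
`C²`. -/
theorem IsInterface.differentiableWithinAt_normal (h : IsInterface Ω Ωm Ωp Γ n) (hx : x ∈ Γ) :
    DifferentiableWithinAt ℝ n Γ x := by
  obtain ⟨U, φ, hU, hxU, hφ, hloc⟩ := h.local_level_set x hx
  have hne := (hloc x hxU).1
  have hf : DifferentiableAt ℝ (fderiv ℝ φ) x :=
    ((hφ.contDiffAt (hU.mem_nhds hxU)).fderiv_right (m := 1) (by norm_num)).differentiableAt
      one_ne_zero
  have hg : DifferentiableAt ℝ (gradient φ) x := sharp.differentiableAt.comp x hf
  have hN : DifferentiableAt ℝ (fun y => ‖gradient φ y‖⁻¹ • gradient φ y) x :=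
    ((hg.norm ℝ hne).inv (norm_ne_zero_iff.2 hne)).smul hg
  refine hN.differentiableWithinAt.congr_of_eventuallyEq ?_ ((hloc x hxU).2.2.2.2 hx)
  filter_upwards [self_mem_nhdsWithin, mem_nhdsWithin_of_mem_nhds (hU.mem_nhds hxU)] with y h1 h2
  exact (hloc y h2).2.2.2.2 h1

theorem IsInterface.hasJump (h : IsInterface Ω Ωm Ωp Γ n) (hx : x ∈ Γ) {V : Type*}
    [NormedAddCommGroup V] [NormedSpace ℝ V] {F : E3 → V} {a b : V}
    (ha : Tendsto F (𝓝[Ωp] x) (𝓝 a)) (hb : Tendsto F (𝓝[Ωm] x) (𝓝 b)) :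
    HasJump F x (n x) (a - b) := by
  refine ⟨a, b, ha.comp (h.isSide_plus.tendsto_ray hx), ?_, rfl⟩
  have := hb.comp (h.isSide_minus.tendsto_ray hx)
  simpa [Function.comp_def, sub_eq_add_neg] using this

theorem HasJump.unique {V : Type*} [NormedAddCommGroup V] [NormedSpace ℝ V] {F : E3 → V}
    {ν : E3} {J J' : V} (h : HasJump F x ν J) (h' : HasJump F x ν J') : J = J' := by
  obtain ⟨a, b, ha, hb, rfl⟩ := h
  obtain ⟨a', b', ha', hb', rfl⟩ := h'
  rw [tendsto_nhds_unique ha ha', tendsto_nhds_unique hb hb']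

end Interface

/-! ### One-sided limits of a Stokes flow -/

/-- The velocity `u` and the pressure `p` solve the Stokes system with viscosity `c` in `D`, and `G`
and `P` are their regular extensions up to `Γ`, where `G` is the interface velocity `q`. -/
structure IsSideFlow (D Γ : Set E3) (n : E3 → E3) (c : ℝ) (u : E3 → E3) (p : E3 → ℝ)
    (g q : E3 → E3) (G : E3 → E3) (P : E3 → ℝ) : Prop where
  contDiffOn_velocity : ContDiffOn ℝ 2 G (D ∪ Γ)
  eqOn_velocity : EqOn u G D
  contDiffOn_pressure : ContDiffOn ℝ 1 P (D ∪ Γ)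
  eqOn_pressure : EqOn p P D
  momentum : ∀ y ∈ D, gradient p y = c • Laplacian.laplacian u y + g y
  incompressible : ∀ y ∈ D, divergence u y = 0
  velocity_eq : ∀ y ∈ Γ, q y = G y
  interface_incompressible : ∀ y ∈ Γ, surfDiv Γ n q y = 0

section SideFlow

variable {D Γ : Set E3} {n ν : E3 → E3} {c : ℝ} {u : E3 → E3} {p : E3 → ℝ} {g q : E3 → E3}
  {G : E3 → E3} {P : E3 → ℝ} {x : E3}

theorem IsSideFlow.hasFDerivWithinAt_velocity (hf : IsSideFlow D Γ n c u p g q G P) (hx : x ∈ Γ) :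
    HasFDerivWithinAt q (fderivWithin ℝ G (D ∪ Γ) x) Γ x :=
  ((((hf.contDiffOn_velocity.differentiableOn two_ne_zero) x
    (Or.inr hx)).hasFDerivWithinAt).mono subset_union_right).congr hf.velocity_eq
    (hf.velocity_eq x hx)

theorem IsSideFlow.hasFDerivWithinAt_fderivWithin_velocity
    (hf : IsSideFlow D Γ n c u p g q G P) (hD : IsSide D Γ ν) (hx : x ∈ Γ) :
    HasFDerivWithinAt (fderivWithin ℝ G (D ∪ Γ))
      (fderivWithin ℝ (fderivWithin ℝ G (D ∪ Γ)) (D ∪ Γ) x) Γ x :=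
  (((hf.contDiffOn_velocity.fderivWithin hD.uniqueDiffOn (m := 1)
    (by norm_num)).differentiableOn one_ne_zero x (Or.inr hx)).hasFDerivWithinAt).mono
    subset_union_right

theorem IsSideFlow.hasFDerivWithinAt_pressure (hf : IsSideFlow D Γ n c u p g q G P)
    (hx : x ∈ Γ) : HasFDerivWithinAt P (fderivWithin ℝ P (D ∪ Γ) x) Γ x :=
  (((hf.contDiffOn_pressure.differentiableOn one_ne_zero) x
    (Or.inr hx)).hasFDerivWithinAt).mono subset_union_right

theorem IsSideFlow.tendsto_fderiv (hf : IsSideFlow D Γ n c u p g q G P) (hD : IsSide D Γ ν)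
    (hx : x ∈ Γ) : Tendsto (fderiv ℝ u) (𝓝[D] x) (𝓝 (fderivWithin ℝ G (D ∪ Γ) x)) :=
  hD.tendsto_fderiv hx (hf.contDiffOn_velocity.of_le (by norm_num)) hf.eqOn_velocity

/-- The normal component of the normal derivative of the velocity vanishes at the interface. -/
theorem IsSideFlow.inner_normal_deriv (hf : IsSideFlow D Γ n c u p g q G P) (hD : IsSide D Γ ν)
    (hn : IsNormalField Γ n) (hx : x ∈ Γ) :
    ⟪n x, fderivWithin ℝ G (D ∪ Γ) x (n x)⟫_ℝ = 0 := by
  have := hD.neBot hx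
  -- The divergence constraint in `D` passes to the limit on `Γ`.
  have htr : LinearMap.trace ℝ E3 (fderivWithin ℝ G (D ∪ Γ) x : E3 →ₗ[ℝ] E3) = 0 := by
    have hc : Continuous fun L : E3 →L[ℝ] E3 => LinearMap.trace ℝ E3 (L : E3 →ₗ[ℝ] E3) := by
      simp only [trace_eq_sum]
      fun_prop
    refine tendsto_nhds_unique ((hc.tendsto _).comp (hf.tendsto_fderiv hD hx))
      (tendsto_const_nhds.congr' ?_)
    filter_upwards [self_mem_nhdsWithin] with y hy
    exact (hf.incompressible y hy).symm
  have h1 := hf.interface_incompressible x hx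
  rw [hn.surfDiv_eq hx (hf.hasFDerivWithinAt_velocity hx), trace_comp_tangProj, htr] at h1
  linarith

/-- The viscous part of the normal traction is `2 c ⟪n, A n⟫ = 0`. -/
theorem IsSideFlow.tendsto_traction (hf : IsSideFlow D Γ n c u p g q G P) (hD : IsSide D Γ ν)
    (hn : IsNormalField Γ n) (hx : x ∈ Γ) {μ : E3 → ℝ} (hμ : ∀ y ∈ D, μ y = c) :
    ∃ T : E3, Tendsto (traction μ u p (n x)) (𝓝[D] x) (𝓝 T) ∧ ⟪T, n x⟫_ℝ = -P x := by
  set A := fderivWithin ℝ G (D ∪ Γ) x with hA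
  refine ⟨-(P x • n x) + c • (A (n x) + ContinuousLinearMap.adjoint A (n x)), ?_, ?_⟩
  · have hp := tendsto_of_eqOn hf.contDiffOn_pressure.continuousOn hf.eqOn_pressure hx
    have hu := hf.tendsto_fderiv hD hx
    have hm : Tendsto μ (𝓝[D] x) (𝓝 c) :=
      tendsto_const_nhds.congr' (by filter_upwards [self_mem_nhdsWithin] with y hy using
        (hμ y hy).symm)
    have ha := ((ContinuousLinearMap.adjoint (𝕜 := ℝ) (E := E3) (F := E3)).continuous.tendsto
      A).comp hu
    exact (hp.smul_const (n x)).neg.add (hm.smul ((tendsto_apply hu (n x)).add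
      (tendsto_apply ha (n x))))
  · have h0 := hf.inner_normal_deriv hD hn hx
    rw [← hA] at h0
    rw [inner_add_left, inner_neg_left, inner_smul_left, inner_smul_left, inner_add_left,
      ContinuousLinearMap.adjoint_inner_left, real_inner_comm (n x) (A (n x)), h0,
      real_inner_self_eq_norm_sq, (hn x hx).1]
    simp

/-- No regularity of `g` is assumed: its limit is read off from the momentum equation. -/
theorem IsSideFlow.tendsto_force (hf : IsSideFlow D Γ n c u p g q G P) (hD : IsSide D Γ ν)
    (hx : x ∈ Γ) :
    Tendsto g (𝓝[D] x) (𝓝 (sharp (fderivWithin ℝ P (D ∪ Γ) x) - c • ∑ i,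
      fderivWithin ℝ (fderivWithin ℝ G (D ∪ Γ)) (D ∪ Γ) x
        (stdOrthonormalBasis ℝ E3 i) (stdOrthonormalBasis ℝ E3 i))) := by
  have hp := (sharp.continuous.tendsto _).comp
    (hD.tendsto_fderiv hx hf.contDiffOn_pressure hf.eqOn_pressure)
  have hu := hD.tendsto_fderiv_fderiv hx hf.contDiffOn_velocity hf.eqOn_velocity
  refine (hp.sub ((tendsto_finsetSum Finset.univ fun i _ =>
    tendsto_apply (tendsto_apply hu _) _).const_smul c)).congr' ?_
  filter_upwards [self_mem_nhdsWithin] with y hy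
  rw [← laplacian_eq_sum_fderiv, sub_eq_iff_eq_add']
  exact hf.momentum y hy

theorem IsSideFlow.tendsto_dirDeriv_dirDeriv (hf : IsSideFlow D Γ n c u p g q G P)
    (hD : IsSide D Γ ν) (hx : x ∈ Γ) (e : E3) :
    Tendsto (dirDeriv e (dirDeriv e u)) (𝓝[D] x)
      (𝓝 (fderivWithin ℝ (fderivWithin ℝ G (D ∪ Γ)) (D ∪ Γ) x e e)) := by
  have hu := hD.tendsto_fderiv_fderiv hx hf.contDiffOn_velocity hf.eqOn_velocity
  refine (tendsto_apply (tendsto_apply hu e) e).congr' ?_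
  filter_upwards [self_mem_nhdsWithin] with y hy
  exact (hD.dirDeriv_dirDeriv hy hf.contDiffOn_velocity hf.eqOn_velocity e).symm

theorem IsSideFlow.surfLaplacian_component (hf : IsSideFlow D Γ n c u p g q G P)
    (hD : IsSide D Γ ν) (hn : IsNormalField Γ n) (hnd : DifferentiableWithinAt ℝ n Γ x)
    (hx : x ∈ Γ) (i : Fin 3) :
    DifferentiableWithinAt ℝ (surfGrad Γ n (fun z => q z i)) Γ x ∧
    surfLaplacian Γ n (fun z => q z i) x
      = ((∑ j, fderivWithin ℝ (fderivWithin ℝ G (D ∪ Γ)) (D ∪ Γ) x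
          (stdOrthonormalBasis ℝ E3 j) (stdOrthonormalBasis ℝ E3 j))
        - fderivWithin ℝ (fderivWithin ℝ G (D ∪ Γ)) (D ∪ Γ) x (n x) (n x)
        - totalCurvature Γ n x • fderivWithin ℝ G (D ∪ Γ) x (n x)) i := by
  let π : E3 →L[ℝ] ℝ := EuclideanSpace.proj i
  let Λ : (E3 →L[ℝ] E3) →L[ℝ] (E3 →L[ℝ] ℝ) := ContinuousLinearMap.compL ℝ E3 E3 ℝ π
  have hψ : ∀ y ∈ Γ, HasFDerivWithinAt (fun z => q z i) (Λ (fderivWithin ℝ G (D ∪ Γ) y)) Γ y :=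
    fun y hy => π.hasFDerivAt.comp_hasFDerivWithinAt y (hf.hasFDerivWithinAt_velocity hy)
  have hα := Λ.hasFDerivAt.comp_hasFDerivWithinAt x
    (hf.hasFDerivWithinAt_fderivWithin_velocity hD hx)
  obtain ⟨h1, h2⟩ := hn.surfLaplacian_eq hx hnd hψ hα
  refine ⟨h1, h2.trans ?_⟩
  simp [Λ, π, mul_comm]

theorem IsSideFlow.surfVecLaplacian_eq (hf : IsSideFlow D Γ n c u p g q G P)
    (hD : IsSide D Γ ν) (hn : IsNormalField Γ n) (hnd : DifferentiableWithinAt ℝ n Γ x)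
    (hx : x ∈ Γ) :
    surfVecLaplacian Γ n q x
      = (∑ j, fderivWithin ℝ (fderivWithin ℝ G (D ∪ Γ)) (D ∪ Γ) x
          (stdOrthonormalBasis ℝ E3 j) (stdOrthonormalBasis ℝ E3 j))
        - fderivWithin ℝ (fderivWithin ℝ G (D ∪ Γ)) (D ∪ Γ) x (n x) (n x)
        - totalCurvature Γ n x • fderivWithin ℝ G (D ∪ Γ) x (n x) := by
  ext i
  exact (hf.surfLaplacian_component hD hn hnd hx i).2

end SideFlow

theorem IsStokesFlow.exists_isSideFlow {Ω Ωm Ωp Γ D : Set E3} {n ν : E3 → E3} {μ : E3 → ℝ}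
    {u : E3 → E3} {p : E3 → ℝ} {g q f : E3 → E3} (hflow : IsStokesFlow Ω Ωm Ωp Γ n μ u p g q f)
    (hD : IsSide D Γ ν) (hDb : D ⊆ Ωm ∪ Ωp) (hDΩ : D ⊆ Ω) (hΓΩ : Γ ⊆ Ω) {c : ℝ}
    (hμ : ∀ y ∈ D, μ y = c) (hu : ContDiffUpTo 2 u D Γ) (hp : ContDiffUpTo 1 p D Γ) :
    ∃ G P, IsSideFlow D Γ n c u p g q G P := by
  obtain ⟨G, hG, huG⟩ := hu
  obtain ⟨P, hP, hpP⟩ := hp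
  refine ⟨G, P, by exact_mod_cast hG, huG, by exact_mod_cast hP, hpP, fun y hy => ?_,
    fun y hy => hflow.incompressible y (hDb hy), fun y hy => ?_, hflow.interface_incompressible⟩
  · rw [hflow.momentum y (hDb hy), hμ y hy]
  -- Continuity of `u` across `Γ` forces the extension to take the value `q` there.
  · have := hD.neBot hy
    rw [hflow.no_slip y hy]
    exact tendsto_nhds_unique
      ((hflow.velocity_continuous y (hΓΩ hy)).mono_left (nhdsWithin_mono y hDΩ))
      (tendsto_of_eqOn hG.continuousOn huG hy)

end StokesInterface

theorem mainTheorem4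
    (Ω Ωm Ωp Γ : Set StokesInterface.E3) (n : StokesInterface.E3 → StokesInterface.E3)
    (hΓ : StokesInterface.IsInterface Ω Ωm Ωp Γ n)
    (μ : StokesInterface.E3 → ℝ) (u : StokesInterface.E3 → StokesInterface.E3)
    (p : StokesInterface.E3 → ℝ) (g q f : StokesInterface.E3 → StokesInterface.E3)
    (hflow : StokesInterface.IsStokesFlow Ω Ωm Ωp Γ n μ u p g q f)
    (x : StokesInterface.E3) (hx : x ∈ Γ) :
    -- the surface derivatives that occur in the formula exist
    (DifferentiableWithinAt ℝ n Γ x ∧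
      DifferentiableWithinAt ℝ (fun y => ⟪f y, n y⟫_ℝ) Γ x ∧
      (∀ i : Fin 3, ∀ y ∈ Γ, DifferentiableWithinAt ℝ (fun z => q z i) Γ y) ∧
      (∀ i : Fin 3,
        DifferentiableWithinAt ℝ (StokesInterface.surfGrad Γ n (fun z => q z i)) Γ x)) ∧
    -- all the jumps exist, and they satisfy the formula
    ∃ (Jμ : ℝ) (Ju : StokesInterface.E3) (Jp : ℝ) (Jg : StokesInterface.E3),
      StokesInterface.HasJump μ x (n x) Jμ ∧
      StokesInterface.HasJump
        (fun y => μ y • StokesInterface.dirDeriv (n x) u y) x (n x) Ju ∧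
      StokesInterface.HasJump (StokesInterface.dirDeriv (n x) p) x (n x) Jp ∧
      StokesInterface.HasJump g x (n x) Jg ∧
      StokesInterface.HasJump
        (fun y => μ y •
          StokesInterface.dirDeriv (n x) (StokesInterface.dirDeriv (n x) u) y) x (n x)
        (-(Jμ • StokesInterface.surfVecLaplacian Γ n q x)
          - StokesInterface.totalCurvature Γ n x • Ju
          + Jp • n x
          - StokesInterface.surfGrad Γ n (fun y => ⟪f y, n y⟫_ℝ) x
          - Jg) := by
  have hn := hΓ.isNormalField
  have hnd := hΓ.differentiableWithinAt_normal hx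
  have hDp := hΓ.isSide_plus
  have hDm := hΓ.isSide_minus
  have hΓΩ : Γ ⊆ Ω := fun y hy => hΓ.union_eq ▸ Or.inl (Or.inr hy)
  obtain ⟨cm, -, hcm⟩ := hflow.viscosity_minus
  obtain ⟨cp, -, hcp⟩ := hflow.viscosity_plus
  obtain ⟨Gp, Pp, hfp⟩ := hflow.exists_isSideFlow hDp subset_union_right
    (fun y hy => hΓ.union_eq ▸ Or.inr hy) hΓΩ hcp hflow.velocity_plus hflow.pressure_plus
  obtain ⟨Gm, Pm, hfm⟩ := hflow.exists_isSideFlow hDm subset_union_left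
    (fun y hy => hΓ.union_eq ▸ Or.inl (Or.inl hy)) hΓΩ hcm hflow.velocity_minus
    hflow.pressure_minus
  have hμp : Tendsto μ (𝓝[Ωp] x) (𝓝 cp) := tendsto_const_nhds.congr' (by
    filter_upwards [self_mem_nhdsWithin] with y hy using (hcp y hy).symm)
  have hμm : Tendsto μ (𝓝[Ωm] x) (𝓝 cm) := tendsto_const_nhds.congr' (by
    filter_upwards [self_mem_nhdsWithin] with y hy using (hcm y hy).symm)
  -- The identity is needed on all of `Γ`, not just at `x`, so that it can be differentiated along
  -- `Γ`.
  have hfn : ∀ y ∈ Γ, ⟪f y, n y⟫_ℝ = -(Pp y - Pm y) := by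
    intro y hy
    obtain ⟨Tp, hTp, hTp'⟩ := hfp.tendsto_traction hDp hn hy hcp
    obtain ⟨Tm, hTm, hTm'⟩ := hfm.tendsto_traction hDm hn hy hcm
    rw [(hflow.stress_balance y hy).unique (hΓ.hasJump hy hTp hTm), inner_sub_left, hTp', hTm']
    ring
  have hfd := (((hfp.hasFDerivWithinAt_pressure hx).sub
    (hfm.hasFDerivWithinAt_pressure hx)).neg).congr hfn (hfn x hx)
  have hKp := hfp.surfVecLaplacian_eq hDp hn hnd hx
  have hKm := hfm.surfVecLaplacian_eq hDm hn hnd hx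
  refine ⟨⟨hnd, hfd.differentiableWithinAt, fun i y hy => ?_,
    fun i => (hfp.surfLaplacian_component hDp hn hnd hx i).1⟩, _, _, _, _,
    hΓ.hasJump hx hμp hμm,
    hΓ.hasJump hx
      (hμp.smul (StokesInterface.tendsto_apply (hfp.tendsto_fderiv hDp hx) (n x)))
      (hμm.smul (StokesInterface.tendsto_apply (hfm.tendsto_fderiv hDm hx) (n x))),
    hΓ.hasJump hx
      (StokesInterface.tendsto_apply
        (hDp.tendsto_fderiv hx hfp.contDiffOn_pressure hfp.eqOn_pressure) (n x))
      (StokesInterface.tendsto_apply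
        (hDm.tendsto_fderiv hx hfm.contDiffOn_pressure hfm.eqOn_pressure) (n x)),
    hΓ.hasJump hx (hfp.tendsto_force hDp hx) (hfm.tendsto_force hDm hx), ?_⟩
  · exact (EuclideanSpace.proj (𝕜 := ℝ) i).hasFDerivAt.comp_hasFDerivWithinAt y
      (hfp.hasFDerivWithinAt_velocity hy) |>.differentiableWithinAt
  · have hJ := hΓ.hasJump hx (hμp.smul (hfp.tendsto_dirDeriv_dirDeriv hDp hx (n x)))
      (hμm.smul (hfm.tendsto_dirDeriv_dirDeriv hDm hx (n x)))
    convert hJ using 1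
    -- Solve the surface Laplacian identity for the second normal derivative on each side.
    rw [sub_right_comm, eq_sub_iff_add_eq, ← eq_sub_iff_add_eq'] at hKp hKm
    rw [hKp, hKm, hn.surfGrad_eq hx hfd, StokesInterface.tangProj_apply]
    -- Here `-∇ₛ(f · n) = [∇p] - [∂p/∂n] n`; its normal part cancels `Jp • n x`, and `[∇p]` cancels
    -- against the one inside `Jg`.
    change _ - _ + _ - (StokesInterface.sharp _ - ⟪n x, StokesInterface.sharp _⟫_ℝ • n x) - _ = _
    rw [real_inner_comm, StokesInterface.inner_sharp, map_neg, map_sub, neg_apply, sub_apply]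
    module
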